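/- **Theorem.** Write $\mathcal F v(\xi)=\int_{\mathbb R}e^{ix\xi}v(x)\,dx$. Let $s>\tfrac12$ and let $\alpha:\mathbb R\to\mathbb R$ be a measurable function for which there are constants $c_1,c_2>0$ with $$c_1(1+|\xi|^{2s})\le\alpha(\xi)\le c_2(1+|\xi|^{2s})\qquad\text{for all }\xi\in\mathbb R .$$ Let $\mathcal L v=\mathcal F^{-1}[\alpha\,\mathcal F v]$. Let $f:\mathbb R\to\mathbb R$ be twice continuously differentiable and satisfy - (F1) $f(0)=0$ and $f(r)>0$ for all $r>0$; - (F2) there exists $p>1$ such that $r^2f'(r)\ge p\,r f(r)$ for all $r\in\mathbb R$; - (F3) there exist $2\le q_1\le q_2$ and $C>0$ such that $|f'(r)|\le C(|r|^{q_1-1}+|r|^{q_2-1})$ for all $r\in\mathbb R$. Let $\varphi\in H^s(\mathbb R)$ be a nontrivial real-valued solution of $\mathcal L\varphi=f(\varphi)$ (in the sense of tempered distributions), and let $\mathcal H v=\mathcal L v-f'(\varphi)v$ be the linearized operator, an unbounded operator in the complex Hilbert space $L^2(\mathbb R)$ with its natural domain $\{v\in L^2(\mathbb R):\alpha\,\mathcal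 F v\in L^2(\mathbb R),\ f'(\varphi)v\in L^2(\mathbb R)\}$ (which is $H^{2s}(\mathbb R)$). Suppose that - (H1) $\mathcal H$ has exactly one negative eigenvalue, and this eigenvalue is simple; - (H2) $\ker\mathcal H=\mathrm{span}\{\varphi'\}$. Then - (H3) the rest of the spectrum of $\mathcal H$ is positive and bounded away from zero: there is $\delta>0$ such that every point of the spectrum of $\mathcal H$ other than $0$ and the negative eigenvalue is a real number $\ge\delta$. -/

import Mathlib

open MeasureTheory FourierTransform
open scoped SchwartzMap LineDeriv ENNReal

noncomputable section

namespace SolitaryWave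

/-- The complex Hilbert space `L²(ℝ)`. -/
abbrev L2 : Type := Lp ℂ 2 (volume : Measure ℝ)

/-! ### Spectral notions for unbounded operators -/

section Spectral

variable {E : Type*} [NormedAddCommGroup E] [NormedSpace ℂ E]

/-- The eigenspace `{x ∈ D(T) : T x = z x}` of an unbounded operator `T`, as a subspace of the
ambient space. -/
def eigenspace (T : E →ₗ.[ℂ] E) (z : ℂ) : Submodule ℂ E :=
  (LinearMap.ker (T.toFun - z • T.domain.subtype)).map T.domain.subtype

/-- `z` is an eigenvalue of `T`. -/
def IsEigenvalue (T : E →ₗ.[ℂ] E) (z : ℂ) : Prop :=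
  eigenspace T z ≠ ⊥

/-- The kernel `{x ∈ D(T) : T x = 0}` of an unbounded operator `T`. -/
def kernel (T : E →ₗ.[ℂ] E) : Submodule ℂ E :=
  (LinearMap.ker T.toFun).map T.domain.subtype

/-- The resolvent set of an unbounded operator `T`: all `z` for which `T - z : D(T) → E` is
bijective with an inverse that is bounded on `E`. -/
def resolventSet (T : E →ₗ.[ℂ] E) : Set ℂ :=
  {z | ∃ R : E →L[ℂ] E,
    (∀ y : E, ∃ h : R y ∈ T.domain, T ⟨R y, h⟩ - z • R y = y) ∧
    (∀ x : T.domain, R (T x - z • (x : E)) = x)}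

/-- The spectrum of an unbounded operator. -/
def spectrum (T : E →ₗ.[ℂ] E) : Set ℂ := (resolventSet T)ᶜ

end Spectral

/-! ### Multiplication operators and Fourier multipliers on `L²(ℝ)` -/

/-- The operator of multiplication by `m` in `L²(ℝ)`, on its maximal domain
`{v ∈ L² : m v ∈ L²}`. -/
def mulOp (m : ℝ → ℝ) : L2 →ₗ.[ℂ] L2 where
  domain :=
    { carrier := {v | MemLp (fun x => (m x : ℂ) * v x) 2 volume}
      add_mem' := by
        intro v w hv hw
        refine (memLp_congr_ae ?_).mpr (hv.add hw)
        filter_upwards [Lp.coeFn_add v w] with x hx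
        exact (congrArg ((m x : ℂ) * ·) hx).trans (mul_add _ _ _)
      zero_mem' := by
        refine (memLp_congr_ae ?_).mpr (MemLp.zero (ε := ℂ))
        filter_upwards [Lp.coeFn_zero ℂ 2 (volume : Measure ℝ)] with x hx
        exact (congrArg ((m x : ℂ) * ·) hx).trans (mul_zero _)
      smul_mem' := by
        intro c v hv
        refine (memLp_congr_ae ?_).mpr (hv.const_smul c)
        filter_upwards [Lp.coeFn_smul c v] with x hx
        exact (congrArg ((m x : ℂ) * ·) hx).trans (mul_left_comm _ _ _) }
  toFun :=
    { toFun := fun v => MemLp.toLp (fun x => (m x : ℂ) * (v : L2) x) v.2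
      map_add' := by
        intro v w
        rw [← MemLp.toLp_add]
        refine MemLp.toLp_congr _ _ ?_
        filter_upwards [Lp.coeFn_add (v : L2) (w : L2)] with x hx
        exact (congrArg ((m x : ℂ) * ·) hx).trans (mul_add _ _ _)
      map_smul' := by
        intro c v
        rw [RingHom.id_apply, ← MemLp.toLp_const_smul]
        refine MemLp.toLp_congr _ _ ?_
        filter_upwards [Lp.coeFn_smul c (v : L2)] with x hx
        exact (congrArg ((m x : ℂ) * ·) hx).trans (mul_left_comm _ _ _) }

/-- The symbol `α`, given for the Fourier transform `∫ e^{i x ξ} v(x) dx`, in the variable `η` of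
Mathlib's Fourier transform `∫ e^{-2 π i x η} v(x) dx`; the two are related by `ξ = -2 π η`. -/
def rescale (α : ℝ → ℝ) : ℝ → ℝ := fun η => α (-(2 * Real.pi * η))

/-- The Fourier multiplier operator `𝓛` with symbol `α`, i.e. `v ↦ F⁻¹[α F v]` with
`F v(ξ) = ∫ e^{i x ξ} v(x) dx`, as an unbounded operator in `L²(ℝ)` on its maximal domain
`{v ∈ L² : α F v ∈ L²}`. -/
def multiplierOp (α : ℝ → ℝ) : L2 →ₗ.[ℂ] L2 where
  domain := (mulOp (rescale α)).domain.comap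
    (Lp.fourierTransformₗᵢ ℝ ℂ).toLinearEquiv.toLinearMap
  toFun := (Lp.fourierTransformₗᵢ ℝ ℂ).symm.toLinearEquiv.toLinearMap ∘ₗ
    (mulOp (rescale α)).toFun ∘ₗ
      ((Lp.fourierTransformₗᵢ ℝ ℂ).toLinearEquiv.toLinearMap.restrict
        (p := (mulOp (rescale α)).domain.comap
          (Lp.fourierTransformₗᵢ ℝ ℂ).toLinearEquiv.toLinearMap)
        (q := (mulOp (rescale α)).domain) (fun _ hv => hv))

/-! ### The assumptions on the symbol and on the nonlinearity -/

/-- The assumption on the symbol: `α` is measurable and comparable to `1 + |ξ|^{2s}`, where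
`s > 1/2`. -/
structure SymbolAssumption (α : ℝ → ℝ) (s : ℝ) : Prop where
  measurable : Measurable α
  half_lt : 1 / 2 < s
  bounds : ∃ c₁ c₂ : ℝ, 0 < c₁ ∧ 0 < c₂ ∧ ∀ ξ : ℝ,
    c₁ * (1 + |ξ| ^ (2 * s)) ≤ α ξ ∧ α ξ ≤ c₂ * (1 + |ξ| ^ (2 * s))

/-- The assumption on the nonlinearity: `f` is `C²` and satisfies (F1), (F2), (F3). -/
structure NonlinearityAssumption (f : ℝ → ℝ) : Prop where
  contDiff : ContDiff ℝ 2 f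
  map_zero : f 0 = 0
  pos : ∀ r : ℝ, 0 < r → 0 < f r
  superlinear : ∃ p : ℝ, 1 < p ∧ ∀ r : ℝ, p * r * f r ≤ r ^ 2 * deriv f r
  growth : ∃ q₁ q₂ C : ℝ, 2 ≤ q₁ ∧ q₁ ≤ q₂ ∧ 0 < C ∧
    ∀ r : ℝ, |deriv f r| ≤ C * (|r| ^ (q₁ - 1) + |r| ^ (q₂ - 1))

/-! ### Solitary waves and the linearized operator -/

/-- A real `L²` function, viewed as a complex-valued one. -/
def toComplex (φ : Lp ℝ 2 (volume : Measure ℝ)) : L2 := Complex.ofRealCLM.compLp φ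

/-- `φ ∈ H^s(ℝ)` is a real-valued solution of `𝓛 φ = f(φ)`, as an equation between tempered
distributions: `𝓛 φ = F⁻¹[α F φ]` pairs with a Schwartz function `ψ` as
`∫ (α F φ) · (F⁻¹ ψ)` (here in the variable of Mathlib's Fourier transform). -/
structure IsSolution (α f : ℝ → ℝ) (s : ℝ) (φ : Lp ℝ 2 (volume : Measure ℝ)) : Prop where
  memSobolev : TemperedDistribution.MemSobolev s 2 (toComplex φ : 𝓢'(ℝ, ℂ))
  equation : ∀ ψ : 𝓢(ℝ, ℂ),
    ∫ η : ℝ, (rescale α η : ℂ) * (𝓕 (toComplex φ) : L2) η * (𝓕⁻ ψ : 𝓢(ℝ, ℂ)) η =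
      ∫ x : ℝ, (f (φ x) : ℂ) * ψ x

/-- The linearized operator `𝓗 v = 𝓛 v - f'(φ) v`, as an unbounded operator in `L²(ℝ)`. Its domain
is the intersection of the domains of the two terms. -/
def linearizedOp (α f : ℝ → ℝ) (φ : Lp ℝ 2 (volume : Measure ℝ)) : L2 →ₗ.[ℂ] L2 :=
  multiplierOp α - mulOp (fun x => deriv f (φ x))

/-! ### The spectral hypotheses -/

/-- (H1): `T` has exactly one negative eigenvalue, which is simple. -/
def H1 (T : L2 →ₗ.[ℂ] L2) : Prop :=
  ∃ l : ℝ, l < 0 ∧ Module.finrank ℂ (eigenspace T (l : ℂ)) = 1 ∧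
    ∀ μ : ℝ, μ < 0 → IsEigenvalue T (μ : ℂ) → μ = l

/-- (H2): the kernel of `T` is spanned by the (distributional) derivative `φ' ∈ L²(ℝ)`. -/
def H2 (T : L2 →ₗ.[ℂ] L2) (φ : Lp ℝ 2 (volume : Measure ℝ)) : Prop :=
  ∃ w : L2, (w : 𝓢'(ℝ, ℂ)) = ∂_{(1 : ℝ)} (toComplex φ : 𝓢'(ℝ, ℂ)) ∧
    kernel T = Submodule.span ℂ {w}

/-- (H3): the rest of the spectrum of `T`, i.e. what remains when the negative eigenvalues and zero
are removed, is real, positive and bounded away from zero. -/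
def H3 (T : L2 →ₗ.[ℂ] L2) : Prop :=
  ∃ δ : ℝ, 0 < δ ∧ ∀ z ∈ spectrum T,
    z ≠ 0 → (¬ ∃ μ : ℝ, μ < 0 ∧ IsEigenvalue T (μ : ℂ) ∧ z = (μ : ℂ)) →
      ∃ r : ℝ, δ ≤ r ∧ z = (r : ℂ)

end SolitaryWave

end

/-!
The linearized operator is `T = A - B`, where `A` is the multiplier with symbol `α ≥ c > 0` and
`B` is the multiplication by `V = f'(φ)`. The point is that `B` is relatively compact with respect
to `A`, so that the spectrum of `T` outside `[c, ∞)` consists of eigenvalues, and the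
positive ones do not accumulate at `0`.

Since `s > 1/2`, the Sobolev embedding bounds `φ`, and the growth condition gives `|V| ≤ C |φ|`;
hence `V` is bounded and square-integrable. For `z` outside `[c, ∞)` the resolvent
`R = (A - z)⁻¹` is the multiplier with symbol `g = (α - z)⁻¹`, which is of order
`(1 + |ξ|)^{-2s}` and therefore bounded and square-integrable too. Up to the Fourier transform,
`B R` is an integral operator with the kernel `V(x) e^{2 π i x ξ} g(ξ)`, which is
square-integrable; thus `B R` is compact (`isCompactOperator_mul_fourierInv_mul`).

From `T - z = (1 - B R) (A - z)` and the Fredholm alternative, every spectral point outside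
`[c, ∞)` is an eigenvalue (`isEigenvalue_of_mem_spectrum`), and it is real because `T` is
symmetric. Finally, positive eigenvalues cannot accumulate at `0`: by compactness the normalized
eigenvectors would subconverge to a unit vector of the kernel, to which they are all orthogonal
(`exists_forall_lt_not_isEigenvalue`).
-/

namespace SolitaryWave

open Filter Topology

/-! ### Relatively compact perturbations -/

section Abstract

variable {E : Type*} [NormedAddCommGroup E]

theorem isEigenvalue_iff [NormedSpace ℂ E] {T : E →ₗ.[ℂ] E} {z : ℂ} :
    IsEigenvalue T z ↔ ∃ x : T.domain, (x : E) ≠ 0 ∧ T x = z • (x : E) := by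
  unfold IsEigenvalue eigenspace
  rw [Submodule.ne_bot_iff]
  constructor
  · rintro ⟨_, ⟨x, hx, rfl⟩, h0⟩
    exact ⟨x, h0, sub_eq_zero.mp hx⟩
  · rintro ⟨x, h0, hx⟩
    exact ⟨x, ⟨x, sub_eq_zero.mpr hx, rfl⟩, h0⟩

/-- The Fredholm alternative for a perturbation `T = A - B` of an operator `A` by a bounded
operator `B` which is relatively compact with respect to `A`: a point `z` of the resolvent set
of `A` is an eigenvalue of `T` or belongs to the resolvent set of `T`. It rests on the factorization
`T - z = (1 - B R) (A - z)`, with `R = (A - z)⁻¹`. -/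
theorem isEigenvalue_of_mem_spectrum [NormedSpace ℂ E] [CompleteSpace E]
    {A T : E →ₗ.[ℂ] E} {B : E →L[ℂ] E}
    (hdom : T.domain = A.domain)
    (hT : ∀ x (h : x ∈ T.domain) (h' : x ∈ A.domain), T ⟨x, h⟩ = A ⟨x, h'⟩ - B x)
    {z : ℂ} {R : E →L[ℂ] E}
    (hR : ∀ y, ∃ h : R y ∈ A.domain, A ⟨R y, h⟩ - z • R y = y)
    (hR' : ∀ x : A.domain, R (A x - z • (x : E)) = x)
    (hK : IsCompactOperator (B ∘L R)) (hz : z ∈ spectrum T) : IsEigenvalue T z := by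
  rcases hK.hasEigenvalue_or_mem_resolventSet (one_ne_zero (α := ℂ)) with h | h
  · obtain ⟨w, hw⟩ := h.exists_hasEigenvector
    have hw1 : B (R w) = w := by simpa using hw.apply_eq_smul
    obtain ⟨hd, hw2⟩ := hR w
    refine isEigenvalue_iff.mpr ⟨⟨R w, hdom ▸ hd⟩, ?_, ?_⟩
    · intro h0
      apply hw.2
      rw [← hw1, show R w = 0 from h0, map_zero]
    · rw [hT _ _ hd, hw1, sub_eq_iff_eq_add.mp hw2, add_sub_cancel_left]
  · exfalso
    apply hz
    obtain ⟨u, hu⟩ : IsUnit (1 - B ∘L R) := by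
      simpa [resolventSet] using spectrum.mem_resolventSet_iff.mp h
    have hu1 : ∀ y, (↑u⁻¹ : E →L[ℂ] E) y - B (R ((↑u⁻¹ : E →L[ℂ] E) y)) = y := fun y => by
      have := congrArg (fun S : E →L[ℂ] E => S y) u.mul_inv
      rw [hu] at this
      simpa using this
    have hu2 : ∀ y, (↑u⁻¹ : E →L[ℂ] E) (y - B (R y)) = y := fun y => by
      have := congrArg (fun S : E →L[ℂ] E => S y) u.inv_mul
      rw [hu] at this
      simpa using this
    refine ⟨R ∘L (↑u⁻¹ : E →L[ℂ] E), fun y => ?_, fun x => ?_⟩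
    · obtain ⟨hd, hw2⟩ := hR ((↑u⁻¹ : E →L[ℂ] E) y)
      refine ⟨hdom ▸ hd, ?_⟩
      have := hT _ (hdom ▸ hd) hd
      simp only [ContinuousLinearMap.comp_apply]
      rw [this, sub_right_comm, hw2, hu1]
    · have hx' : (x : E) ∈ A.domain := hdom ▸ x.2
      have h1 := hR' ⟨x, hx'⟩
      have h2 := hu2 (A ⟨x, hx'⟩ - z • (x : E))
      rw [h1] at h2
      rw [hT x x.2 hx', ContinuousLinearMap.comp_apply, sub_right_comm, h2, h1]

variable [InnerProductSpace ℂ E]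

/-- An eigenvalue of a symmetric operator is real. -/
theorem IsEigenvalue.eq_re {T : E →ₗ.[ℂ] E}
    (hsymm : ∀ x y : T.domain, inner ℂ (T x) (y : E) = inner ℂ (x : E) (T y))
    {z : ℂ} (hz : IsEigenvalue T z) : z = (z.re : ℂ) := by
  obtain ⟨x, h0, hx⟩ := isEigenvalue_iff.mp hz
  have h := hsymm x x
  rw [hx, inner_smul_left, inner_smul_right] at h
  exact (Complex.conj_eq_iff_re.mp (mul_right_cancel₀ (inner_self_ne_zero.mpr h0) h)).symm

/-- Small positive numbers are not eigenvalues of `T = A - B`, if `T` is symmetric, `A` is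
invertible and `B A⁻¹` is compact. Otherwise normalized eigenvectors `x n` to eigenvalues
tending to `0` would converge along a subsequence to a unit vector in the kernel of `T`, which
is orthogonal to all the `x n`. -/
theorem exists_forall_lt_not_isEigenvalue {A T : E →ₗ.[ℂ] E} {B : E →L[ℂ] E}
    (hdom : T.domain = A.domain)
    (hT : ∀ x (h : x ∈ T.domain) (h' : x ∈ A.domain), T ⟨x, h⟩ = A ⟨x, h'⟩ - B x)
    (hsymm : ∀ x y : T.domain, inner ℂ (T x) (y : E) = inner ℂ (x : E) (T y))
    {R : E →L[ℂ] E} (hR : ∀ y, ∃ h : R y ∈ A.domain, A ⟨R y, h⟩ = y)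
    (hR' : ∀ x : A.domain, R (A x) = x) (hK : IsCompactOperator (B ∘L R)) :
    ∃ δ : ℝ, 0 < δ ∧ ∀ μ : ℝ, 0 < μ → μ < δ → ¬ IsEigenvalue T (μ : ℂ) := by
  by_contra! hcon
  have key : ∀ n : ℕ, ∃ μ : ℝ, 0 < μ ∧ μ < 1 / ((n : ℝ) + 1) ∧ ∃ x : T.domain,
      ‖(x : E)‖ = 1 ∧ T x = (μ : ℂ) • (x : E) := fun n => by
    obtain ⟨μ, h0, h1, h2⟩ := hcon (1 / ((n : ℝ) + 1)) (by positivity)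
    obtain ⟨x, hx0, hx⟩ := isEigenvalue_iff.mp h2
    refine ⟨μ, h0, h1, ((‖(x : E)‖⁻¹ : ℝ) : ℂ) • x, ?_, ?_⟩
    · rw [Submodule.coe_smul, norm_smul, Complex.norm_real, norm_inv, norm_norm,
        inv_mul_cancel₀ (norm_ne_zero_iff.mpr hx0)]
    · rw [T.map_smul, hx, Submodule.coe_smul, smul_comm]
  choose μ hμ0 hμ1 x hx1 hx using key
  have hμ : Tendsto μ atTop (𝓝 0) :=
    squeeze_zero (fun n => (hμ0 n).le) (fun n => (hμ1 n).le) tendsto_one_div_add_atTop_nhds_zero_nat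
  have hxA : ∀ n, (x n : E) ∈ A.domain := fun n => hdom ▸ (x n).2
  -- Since `w n = B (R (w n)) + μ n • x n` with `μ n → 0`, compactness of `B R` makes a subsequence
  -- of `w n` converge, and with it `x n = R (w n)`.
  set w : ℕ → E := fun n => A ⟨x n, hxA n⟩ with hw
  have hw1 : ∀ n, w n = B (x n) + (μ n : ℂ) • (x n : E) := fun n => by
    have := hT _ (x n).2 (hxA n)
    rw [← hx n, this, hw, add_sub_cancel]
  have hRw : ∀ n, R (w n) = x n := fun n => hR' _
  have hwb : ∀ n, w n ∈ Metric.closedBall (0 : E) (‖B‖ + 1) := fun n => by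
    rw [mem_closedBall_zero_iff, hw1]
    refine (norm_add_le _ _).trans (add_le_add ?_ ?_)
    · simpa [hx1] using B.le_opNorm (x n)
    · rw [norm_smul, hx1, mul_one, Complex.norm_real, Real.norm_of_nonneg (hμ0 n).le]
      refine (hμ1 n).le.trans ?_
      rw [div_le_one (by positivity)]
      simp
  obtain ⟨C, hC, hCK⟩ := hK.image_closedBall_subset_compact (‖B‖ + 1)
  obtain ⟨y, -, φ, hφ, hy⟩ := hC.tendsto_subseq (fun n => hCK ⟨_, hwb n, rfl⟩)
  have hμx : Tendsto (fun n => (μ n : ℂ) • (x n : E)) atTop (𝓝 0) := by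
    refine squeeze_zero_norm (fun n => ?_) hμ
    rw [norm_smul, hx1, mul_one, Complex.norm_real, Real.norm_of_nonneg (hμ0 n).le]
  have hwy : Tendsto (w ∘ φ) atTop (𝓝 y) := by
    have := hy.add (hμx.comp hφ.tendsto_atTop)
    rw [add_zero] at this
    refine this.congr fun n => ?_
    simp [hw1 (φ n), hRw]
  have hxy : Tendsto (fun n => (x (φ n) : E)) atTop (𝓝 (R y)) :=
    ((R.continuous.tendsto y).comp hwy).congr fun n => hRw _
  have hKy : B (R y) = y :=
    tendsto_nhds_unique (((B ∘L R).continuous.tendsto y).comp hwy) hy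
  obtain ⟨hd, hAy⟩ := hR y
  have hTy : T ⟨R y, hdom ▸ hd⟩ = 0 := by rw [hT _ _ hd, hAy, hKy, sub_self]
  have hnorm : ‖R y‖ = 1 :=
    tendsto_nhds_unique hxy.norm (by simp [hx1])
  have horth : ∀ n, inner ℂ (x n : E) (R y) = 0 := fun n => by
    have h := hsymm (x n) ⟨R y, hdom ▸ hd⟩
    rw [hTy, hx, inner_smul_left, inner_zero_right] at h
    exact (mul_eq_zero.mp h).resolve_left (by simpa using (hμ0 n).ne')
  have h0 : inner ℂ (R y) (R y) = (0 : ℂ) :=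
    tendsto_nhds_unique (hxy.inner (𝕜 := ℂ) tendsto_const_nhds) (by simp [horth])
  rw [inner_self_eq_zero.mp h0, norm_zero] at hnorm
  exact zero_ne_one hnorm

end Abstract

/-! ### Operators with square-integrable kernels -/

/-- The operator `v ↦ (x ↦ k x v)` with kernel `k ∈ L²(ℝ; E')` is compact: it depends
continuously on `k`, and it has rank one if `k` is an indicator function times a constant. -/
theorem isCompactOperator_of_kernel {E : Type*} [NormedAddCommGroup E] [NormedSpace ℂ E]
    (k : Lp (E →L[ℂ] ℂ) 2 (volume : Measure ℝ)) :
    IsCompactOperator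
      ((ContinuousLinearMap.compLpL₂ 2 (volume : Measure ℝ)
        (ContinuousLinearMap.apply ℂ ℂ : E →L[ℂ] (E →L[ℂ] ℂ) →L[ℂ] ℂ)).flip k) := by
  set Φ := (ContinuousLinearMap.compLpL₂ 2 (volume : Measure ℝ)
        (ContinuousLinearMap.apply ℂ ℂ : E →L[ℂ] (E →L[ℂ] ℂ) →L[ℂ] ℂ)).flip with hΦ
  have hp : (2 : ℝ≥0∞) ≠ ∞ := ENNReal.ofNat_ne_top
  induction k using Lp.induction (p := 2) hp with
  | indicatorConst c hs hμs =>
    rename_i s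
    have : Φ (Lp.simpleFunc.indicatorConst 2 hs hμs.ne c : Lp (E →L[ℂ] ℂ) 2 volume) =
        (ContinuousLinearMap.toSpanSingleton ℂ
          (indicatorConstLp 2 hs hμs.ne (1 : ℂ) : Lp ℂ 2 (volume : Measure ℝ))) ∘L c := by
      ext1 v
      rw [Lp.simpleFunc.coe_indicatorConst]
      refine Lp.ext ?_
      simp only [hΦ, ContinuousLinearMap.flip_apply, ContinuousLinearMap.compLpL₂_apply_apply,
        ContinuousLinearMap.comp_apply, ContinuousLinearMap.toSpanSingleton_apply]
      filter_upwards [ContinuousLinearMap.coeFn_compLp (ContinuousLinearMap.apply ℂ ℂ v)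
          (indicatorConstLp 2 hs hμs.ne c), indicatorConstLp_coeFn (p := 2) (hs := hs)
          (hμs := hμs.ne) (c := c), indicatorConstLp_coeFn (p := 2) (hs := hs)
          (hμs := hμs.ne) (c := (1 : ℂ)), Lp.coeFn_smul (c v)
          (indicatorConstLp 2 hs hμs.ne (1 : ℂ) : Lp ℂ 2 (volume : Measure ℝ))] with x h1 h2 h3 h4
      rw [h1, h2, h4, Pi.smul_apply, h3]
      by_cases hx : x ∈ s <;> simp [hx]
    rw [this]
    have h1 : IsCompactOperator (ContinuousLinearMap.toSpanSingleton ℂ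
          (indicatorConstLp 2 hs hμs.ne (1 : ℂ) : Lp ℂ 2 (volume : Measure ℝ))) :=
      isCompactOperator_id.clm_comp _
    exact h1.comp_clm c
  | add hf hg _ h1 h2 =>
    rw [map_add]
    exact h1.add h2
  | isClosed => exact isClosed_setOfPred_isCompactOperator.preimage Φ.continuous

/-! ### The inverse Fourier integral and compactness of `V F⁻¹ g` -/

/-- If the Fourier transform of `u ∈ L²` is an integrable function `v`, then `u` is almost
everywhere equal to the inverse Fourier integral of `v`. -/
theorem ae_eq_fourierInv_of_fourier_eq (u : L2) (v : Lp ℂ 1 (volume : Measure ℝ))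
    (h : 𝓕 (u : 𝓢'(ℝ, ℂ)) = (v : 𝓢'(ℝ, ℂ))) :
    u =ᵐ[volume] 𝓕⁻ (v : ℝ → ℂ) := by
  have hv : Integrable (v : ℝ → ℂ) := L1.integrable_coeFn v
  have hL : Continuous fun p : ℝ × ℝ => (-innerₗ ℝ : ℝ →ₗ[ℝ] ℝ →ₗ[ℝ] ℝ) p.1 p.2 :=
    continuous_inner.neg
  have hcont : Continuous (𝓕⁻ (v : ℝ → ℂ)) :=
    VectorFourier.fourierIntegral_continuous Real.continuous_fourierChar hL hv
  refine ae_eq_of_integral_contDiff_smul_eq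
    ((Lp.memLp u).locallyIntegrable (by simp)) hcont.locallyIntegrable fun g hg hgs => ?_
  have hg' : ContDiff ℝ (⊤ : ℕ∞) (Complex.ofRealCLM ∘ g) := Complex.ofRealCLM.contDiff.comp hg
  have hgs' : HasCompactSupport (Complex.ofRealCLM ∘ g) := hgs.comp_left (map_zero _)
  obtain ⟨ψ, hψ⟩ : ∃ ψ : 𝓢(ℝ, ℂ), ∀ x, ψ x = (g x : ℂ) :=
    ⟨hgs'.toSchwartzMap hg', fun x => by simp⟩
  have h1 : (u : 𝓢'(ℝ, ℂ)) ψ = (v : 𝓢'(ℝ, ℂ)) (𝓕⁻ ψ) := by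
    rw [← h, TemperedDistribution.fourier_apply, fourier_fourierInv_eq]
  rw [Lp.toTemperedDistribution_apply, Lp.toTemperedDistribution_apply] at h1
  have h2 : ∫ x, (𝓕⁻ ψ : 𝓢(ℝ, ℂ)) x • v x = ∫ x, ψ x • 𝓕⁻ (v : ℝ → ℂ) x := by
    have h3 := VectorFourier.integral_fourierIntegral_smul_eq_flip (μ := volume) (ν := volume)
      (L := -innerₗ ℝ) (f := ψ) (g := v) Real.continuous_fourierChar hL ψ.integrable hv
    have hflip : (-innerₗ ℝ : ℝ →ₗ[ℝ] ℝ →ₗ[ℝ] ℝ).flip = -innerₗ ℝ := by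
      ext; simp
    rw [hflip] at h3
    rw [SchwartzMap.fourierInv_coe]
    exact h3
  rw [h2] at h1
  simp only [hψ, Complex.coe_smul] at h1
  exact h1

/-- The multiplication operator on `L²` by an essentially bounded function. -/
noncomputable def mulCLM (m : ℝ → ℂ) (hm : MemLp m ∞ volume) : L2 →L[ℂ] L2 :=
  (ContinuousLinearMap.mul ℂ ℂ).holderL volume ∞ 2 2 hm.toLp

theorem coeFn_mulCLM {m : ℝ → ℂ} (hm : MemLp m ∞ volume) (v : L2) :
    mulCLM m hm v =ᵐ[volume] fun x => m x * v x := by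
  filter_upwards [(ContinuousLinearMap.mul ℂ ℂ).coeFn_holder (r := 2) hm.toLp v, hm.coeFn_toLp]
    with x h1 h2
  exact h1.trans (by simp [h2])

/-- The modulation `ξ ↦ e^{2 π i ξ x} g(ξ)` of `g ∈ L²` is square-integrable. -/
theorem memLp_modulation {g : ℝ → ℂ} (hg : MemLp g 2 volume) (x : ℝ) :
    MemLp (fun ξ => Real.fourierChar (inner ℝ ξ x) • g ξ) 2 volume := by
  refine (memLp_congr_norm ?_ hg.1 (by simp)).mpr hg
  have : Continuous fun ξ : ℝ => Real.fourierChar (inner ℝ ξ x) :=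
    Real.continuous_fourierChar.comp (by fun_prop)
  exact this.aestronglyMeasurable.smul hg.1

theorem norm_modulation {g : ℝ → ℂ} (hg : MemLp g 2 volume) (x : ℝ) :
    ‖(memLp_modulation hg x).toLp‖ = ‖hg.toLp‖ := by
  rw [Lp.norm_toLp, Lp.norm_toLp]
  congr 1
  exact eLpNorm_congr_norm_ae (by simp)

/-- Modulation is continuous in `L²`, by dominated convergence with the bound `4 |g|²`. -/
theorem continuous_modulation {g : ℝ → ℂ} (hg : MemLp g 2 volume) :
    Continuous fun x => (memLp_modulation hg x).toLp := by
  have hgi : Integrable (fun ξ => ‖g ξ‖ ^ 2) := hg.integrable_norm_pow (by simp)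
  rw [continuous_iff_continuousAt]
  intro y
  rw [ContinuousAt, tendsto_iff_norm_sub_tendsto_zero]
  have hI : ∀ x, ‖(memLp_modulation hg x).toLp - (memLp_modulation hg y).toLp‖ =
      √ (∫ ξ, ‖(Real.fourierChar (inner ℝ ξ x) : ℂ) - Real.fourierChar (inner ℝ ξ y)‖ ^ 2 *
        ‖g ξ‖ ^ 2) := fun x => by
    rw [← MemLp.toLp_sub, ← Real.sqrt_sq (norm_nonneg _), ← inner_self_eq_norm_sq (𝕜 := ℂ),
      L2.inner_def, ← integral_re (L2.integrable_inner _ _)]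
    congr 1
    refine integral_congr_ae ?_
    filter_upwards [((memLp_modulation hg x).sub (memLp_modulation hg y)).coeFn_toLp] with ξ h
    rw [inner_self_eq_norm_sq, h, ← mul_pow, ← norm_mul, sub_mul]
    rfl
  simp_rw [hI]
  rw [← Real.sqrt_zero]
  refine (Real.continuous_sqrt.tendsto 0).comp ?_
  have : Tendsto (fun x => ∫ ξ, ‖(Real.fourierChar (inner ℝ ξ x) : ℂ) -
      Real.fourierChar (inner ℝ ξ y)‖ ^ 2 * ‖g ξ‖ ^ 2) (𝓝 y) (𝓝 (∫ _ : ℝ, (0 : ℝ))) := by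
    refine tendsto_integral_filter_of_dominated_convergence (fun ξ => 4 * ‖g ξ‖ ^ 2) ?_ ?_
      (hgi.const_mul 4) ?_
    · refine Eventually.of_forall fun x => ?_
      refine AEStronglyMeasurable.mul ?_ hgi.1
      refine Continuous.aestronglyMeasurable ?_
      have : ∀ x : ℝ, Continuous fun ξ : ℝ => (Real.fourierChar (inner ℝ ξ x) : ℂ) := fun x =>
        continuous_subtype_val.comp (Real.continuous_fourierChar.comp (by fun_prop))
      exact ((this x).sub (this y)).norm.pow 2
    · refine Eventually.of_forall fun x => Eventually.of_forall fun ξ => ?_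
      have : ‖(Real.fourierChar (inner ℝ ξ x) : ℂ) - Real.fourierChar (inner ℝ ξ y)‖ ≤ 2 := by
        refine (norm_sub_le _ _).trans ?_
        simp only [Circle.norm_coe]
        norm_num
      rw [Real.norm_of_nonneg (by positivity)]
      gcongr
      nlinarith [norm_nonneg ((Real.fourierChar (inner ℝ ξ x) : ℂ) -
        Real.fourierChar (inner ℝ ξ y))]
    · refine Eventually.of_forall fun ξ => ?_
      have hc : Continuous fun x : ℝ => ‖(Real.fourierChar (inner ℝ ξ x) : ℂ) -
          Real.fourierChar (inner ℝ ξ y)‖ ^ 2 * ‖g ξ‖ ^ 2 := by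
        have : Continuous fun x : ℝ => (Real.fourierChar (inner ℝ ξ x) : ℂ) :=
          continuous_subtype_val.comp (Real.continuous_fourierChar.comp (by fun_prop))
        fun_prop
      simpa using hc.tendsto y
  simpa using this

/-- The operator `V F⁻¹ g` (a Fourier multiplier followed by a multiplication, up to a Fourier
transform) is compact for `V, g ∈ L²`, since its kernel `V(x) e^{2 π i x ξ} g(ξ)` is
square-integrable. -/
theorem isCompactOperator_mul_fourierInv_mul {V g : ℝ → ℂ} (hV : MemLp V 2 volume)
    (hV' : MemLp V ∞ volume) (hg : MemLp g 2 volume) (hg' : MemLp g ∞ volume) :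
    IsCompactOperator fun v : L2 => mulCLM V hV' (𝓕⁻ (mulCLM g hg' v) : L2) := by
  set P : L2 →L[ℂ] L2 →L[ℂ] ℂ :=
    ContinuousLinearMap.lpPairing volume 2 2 (ContinuousLinearMap.mul ℂ ℂ) with hP
  have hk : MemLp (fun x => V x • P (memLp_modulation hg x).toLp) 2 volume := by
    refine hV.of_le_mul (c := ‖P‖ * ‖hg.toLp‖) ?_ (Eventually.of_forall fun x => ?_)
    · exact hV.1.smul (P.continuous.comp (continuous_modulation hg)).aestronglyMeasurable
    · rw [norm_smul, mul_comm, ← norm_modulation hg x]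
      gcongr
      exact P.le_opNorm _
  have hcomp := isCompactOperator_of_kernel hk.toLp
  suffices h : (fun v : L2 => mulCLM V hV' (𝓕⁻ (mulCLM g hg' v) : L2)) =
      (ContinuousLinearMap.compLpL₂ 2 (volume : Measure ℝ)
        (ContinuousLinearMap.apply ℂ ℂ : L2 →L[ℂ] (L2 →L[ℂ] ℂ) →L[ℂ] ℂ)).flip hk.toLp by
    rw [h]
    exact hcomp
  funext v
  refine Lp.ext ?_
  set w : L2 := mulCLM g hg' v with hw
  have hwi : Integrable (fun ξ => g ξ * v ξ) := hg.integrable_mul (Lp.memLp v)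
  have hw1 : MemLp (w : ℝ → ℂ) 1 volume :=
    memLp_one_iff_integrable.mpr (hwi.congr (coeFn_mulCLM hg' v).symm)
  have hF : 𝓕 ((𝓕⁻ w : L2) : 𝓢'(ℝ, ℂ)) = ((hw1.toLp : Lp ℂ 1 volume) : 𝓢'(ℝ, ℂ)) := by
    rw [Lp.fourier_toTemperedDistribution_eq, fourier_fourierInv_eq]
    ext ψ
    rw [Lp.toTemperedDistribution_apply, Lp.toTemperedDistribution_apply]
    refine integral_congr_ae ?_
    filter_upwards [hw1.coeFn_toLp] with ξ h
    rw [h]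
  filter_upwards [coeFn_mulCLM hV' (𝓕⁻ w : L2), ae_eq_fourierInv_of_fourier_eq _ _ hF,
    ContinuousLinearMap.coeFn_compLp (ContinuousLinearMap.apply ℂ ℂ v) hk.toLp, hk.coeFn_toLp]
    with x h1 h2 h3 h4
  rw [h1, h2]
  refine Eq.trans ?_ h3.symm
  rw [h4, ContinuousLinearMap.apply_apply, smul_apply, smul_eq_mul, hP,
    ContinuousLinearMap.lpPairing_eq_integral, Real.fourierInv_eq]
  congr 1
  refine integral_congr_ae ?_
  filter_upwards [hw1.coeFn_toLp, coeFn_mulCLM hg' v, (memLp_modulation hg x).coeFn_toLp]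
    with ξ h5 h6 h7
  rw [h5, h7, hw, h6]
  simp [Circle.smul_def, mul_assoc]

/-! ### Multiplication operators and Fourier multipliers -/

theorem coeFn_mulOp {m : ℝ → ℝ} (v : (mulOp m).domain) :
    mulOp m v =ᵐ[volume] fun x => (m x : ℂ) * (v : L2) x :=
  MemLp.coeFn_toLp v.2

theorem mem_mulOp_domain {m : ℝ → ℝ} {v : L2} :
    v ∈ (mulOp m).domain ↔ MemLp (fun x => (m x : ℂ) * v x) 2 volume := Iff.rfl

theorem mulOp_symmetric (m : ℝ → ℝ) (v w : (mulOp m).domain) :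
    inner ℂ (mulOp m v) (w : L2) = inner ℂ (v : L2) (mulOp m w) := by
  rw [L2.inner_def, L2.inner_def]
  refine integral_congr_ae ?_
  filter_upwards [coeFn_mulOp v, coeFn_mulOp w] with x h1 h2
  rw [h1, h2]
  simp only [RCLike.inner_apply, map_mul, Complex.conj_ofReal]
  ring

theorem multiplierOp_mem_domain {α : ℝ → ℝ} {v : L2} :
    v ∈ (multiplierOp α).domain ↔ (𝓕 v : L2) ∈ (mulOp (rescale α)).domain := Iff.rfl

theorem fourier_multiplierOp {α : ℝ → ℝ} (v : L2) (h : v ∈ (multiplierOp α).domain) :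
    (𝓕 (multiplierOp α ⟨v, h⟩) : L2) =
      mulOp (rescale α) ⟨𝓕 v, multiplierOp_mem_domain.mp h⟩ :=
  (Lp.fourierTransformₗᵢ ℝ ℂ).apply_symm_apply _

theorem multiplierOp_symmetric (α : ℝ → ℝ) (v w : (multiplierOp α).domain) :
    inner ℂ (multiplierOp α v) (w : L2) = inner ℂ (v : L2) (multiplierOp α w) := by
  rw [← Lp.inner_fourier_eq, ← Lp.inner_fourier_eq (v : L2), fourier_multiplierOp _ v.2,
    fourier_multiplierOp _ w.2]
  exact mulOp_symmetric _ ⟨𝓕 (v : L2), multiplierOp_mem_domain.mp v.2⟩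
    ⟨𝓕 (w : L2), multiplierOp_mem_domain.mp w.2⟩

theorem mem_mulOp_domain_of_memLp_top {m : ℝ → ℝ} (hm : MemLp (fun x => (m x : ℂ)) ∞ volume)
    (v : L2) : v ∈ (mulOp m).domain :=
  (memLp_congr_ae (coeFn_mulCLM hm v)).mp (Lp.memLp _)

theorem mulOp_eq_mulCLM {m : ℝ → ℝ} (hm : MemLp (fun x => (m x : ℂ)) ∞ volume)
    (v : (mulOp m).domain) : mulOp m v = mulCLM _ hm v :=
  Lp.ext ((coeFn_mulOp v).trans (coeFn_mulCLM hm v).symm)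

/-- The Fourier multiplier with bounded symbol `g`, as a bounded operator on `L²`. -/
noncomputable def multiplierCLM (g : ℝ → ℂ) (hg : MemLp g ∞ volume) : L2 →L[ℂ] L2 :=
  (Lp.fourierTransformₗᵢ ℝ ℂ).symm.toContinuousLinearEquiv.toContinuousLinearMap ∘L
    mulCLM g hg ∘L (Lp.fourierTransformₗᵢ ℝ ℂ).toContinuousLinearEquiv.toContinuousLinearMap

theorem multiplierCLM_apply {g : ℝ → ℂ} (hg : MemLp g ∞ volume) (v : L2) :
    multiplierCLM g hg v = 𝓕⁻ (mulCLM g hg (𝓕 v : L2)) := rfl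

theorem fourier_multiplierCLM {g : ℝ → ℂ} (hg : MemLp g ∞ volume) (v : L2) :
    (𝓕 (multiplierCLM g hg v) : L2) =ᵐ[volume] fun ξ => g ξ * (𝓕 v : L2) ξ := by
  rw [multiplierCLM_apply, fourier_fourierInv_eq]
  exact coeFn_mulCLM hg _

theorem eq_of_fourier_ae_eq {v w : L2} (h : (𝓕 v : L2) =ᵐ[volume] (𝓕 w : L2)) : v = w :=
  (Lp.fourierTransformₗᵢ ℝ ℂ).injective (Lp.ext h)

/-- The multiplier with symbol `g = (α - z)⁻¹` is a right inverse of `multiplierOp α - z`. -/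
theorem multiplierOp_multiplierCLM {α : ℝ → ℝ} {z : ℂ} {g : ℝ → ℂ} (hg : MemLp g ∞ volume)
    (hgα : ∀ η, ((rescale α η : ℂ) - z) * g η = 1) (y : L2) :
    ∃ h : multiplierCLM g hg y ∈ (multiplierOp α).domain,
      multiplierOp α ⟨multiplierCLM g hg y, h⟩ - z • multiplierCLM g hg y = y := by
  have hmul : (fun η => (rescale α η : ℂ) * (𝓕 (multiplierCLM g hg y) : L2) η) =ᵐ[volume]
      ((𝓕 y + z • 𝓕 (multiplierCLM g hg y) : L2) : ℝ → ℂ) := by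
    filter_upwards [fourier_multiplierCLM hg y, Lp.coeFn_add (𝓕 y : L2)
      (z • 𝓕 (multiplierCLM g hg y)), Lp.coeFn_smul z (𝓕 (multiplierCLM g hg y) : L2)]
      with η h1 h2 h3
    rw [h2, Pi.add_apply, h3, Pi.smul_apply, h1, smul_eq_mul]
    linear_combination (𝓕 y : L2) η * hgα η
  have hd : multiplierCLM g hg y ∈ (multiplierOp α).domain :=
    multiplierOp_mem_domain.mpr (mem_mulOp_domain.mpr ((memLp_congr_ae hmul).mpr (Lp.memLp _)))
  refine ⟨hd, eq_of_fourier_ae_eq ?_⟩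
  have : (𝓕 (multiplierOp α ⟨multiplierCLM g hg y, hd⟩) : L2) =
      𝓕 y + z • 𝓕 (multiplierCLM g hg y) := by
    rw [fourier_multiplierOp]
    exact Lp.ext ((coeFn_mulOp _).trans hmul)
  rw [sub_eq_add_neg, FourierTransform.fourier_add, this, ← neg_smul,
    FourierTransform.fourier_smul, neg_smul, add_neg_cancel_right]

/-- The multiplier with symbol `g = (α - z)⁻¹` is a left inverse of `multiplierOp α - z`. -/
theorem multiplierCLM_multiplierOp {α : ℝ → ℝ} {z : ℂ} {g : ℝ → ℂ} (hg : MemLp g ∞ volume)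
    (hgα : ∀ η, ((rescale α η : ℂ) - z) * g η = 1) (x : (multiplierOp α).domain) :
    multiplierCLM g hg (multiplierOp α x - z • (x : L2)) = x := by
  refine eq_of_fourier_ae_eq ?_
  have h0 : (𝓕 (multiplierOp α x - z • (x : L2)) : L2) =
      mulOp (rescale α) ⟨𝓕 (x : L2), multiplierOp_mem_domain.mp x.2⟩ + (-z) • 𝓕 (x : L2) := by
    rw [sub_eq_add_neg, FourierTransform.fourier_add, ← neg_smul,
      FourierTransform.fourier_smul, fourier_multiplierOp _ x.2]
  have h1 := fourier_multiplierCLM hg (multiplierOp α x - z • (x : L2))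
  rw [h0] at h1
  filter_upwards [h1, Lp.coeFn_add (mulOp (rescale α) ⟨𝓕 (x : L2), multiplierOp_mem_domain.mp x.2⟩)
      ((-z) • 𝓕 (x : L2)),
    Lp.coeFn_smul (-z) (𝓕 (x : L2) : L2),
    coeFn_mulOp (m := rescale α) ⟨𝓕 (x : L2), multiplierOp_mem_domain.mp x.2⟩] with η h1 h2 h3 h4
  rw [h1, h2, Pi.add_apply, h3, Pi.smul_apply, h4, smul_eq_mul]
  linear_combination (𝓕 (x : L2) : L2) η * hgα η

/-! ### The resolvent symbol -/

section Symbol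

/-- For `z` outside `[c, ∞)`, the distance from `z` to `a ≥ c` is comparable to `a`. With
`t = a⁻¹` this is a positive lower bound of `|1 - z t|` on the compact interval `[0, c⁻¹]`. -/
theorem exists_mul_le_norm_sub {c : ℝ} (hc : 0 < c) {z : ℂ} (hz : ∀ r : ℝ, c ≤ r → z ≠ r) :
    ∃ ε : ℝ, 0 < ε ∧ ∀ a : ℝ, c ≤ a → ε * a ≤ ‖(a : ℂ) - z‖ := by
  obtain ⟨t, ht, hmin⟩ := (isCompact_Icc (a := (0 : ℝ)) (b := c⁻¹)).exists_isMinOn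
    ⟨0, by simp [hc.le]⟩ (f := fun t : ℝ => ‖1 - z * t‖) (by fun_prop)
  refine ⟨‖1 - z * t‖, norm_pos_iff.mpr fun h => ?_, fun a ha => ?_⟩
  · have ht0 : t ≠ 0 := by
      rintro rfl
      simp at h
    have htpos : 0 < t := lt_of_le_of_ne ht.1 ht0.symm
    refine hz t⁻¹ ((le_inv_comm₀ hc htpos).mpr ht.2) ?_
    rw [Complex.ofReal_inv]
    exact eq_inv_of_mul_eq_one_left (sub_eq_zero.mp h).symm
  · have ha0 : 0 < a := hc.trans_le ha
    have h := hmin (show a⁻¹ ∈ Set.Icc 0 c⁻¹ from ⟨by positivity, by gcongr⟩)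
    calc ‖1 - z * t‖ * a ≤ ‖1 - z * (a⁻¹ : ℝ)‖ * a := by
          gcongr
          exact h
      _ = ‖(1 - z * (a⁻¹ : ℝ)) * a‖ := by
          rw [norm_mul, Complex.norm_real, Real.norm_of_nonneg ha0.le]
      _ = ‖(a : ℂ) - z‖ := by
          congr 1
          have : (a : ℂ) ≠ 0 := by exact_mod_cast ha0.ne'
          push_cast
          field_simp

variable {α : ℝ → ℝ} {s : ℝ}

/-- The symbol is bounded below by a multiple of `(1 + |η|)^{2s}`. -/
theorem SymbolAssumption.exists_le_rescale (hα : SymbolAssumption α s) :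
    ∃ c : ℝ, 0 < c ∧ ∀ η, c * (1 + ‖η‖) ^ (2 * s) ≤ rescale α η := by
  obtain ⟨c₁, _, hc₁, -, hb⟩ := hα.bounds
  have hs : 0 < 2 * s := by linarith [hα.half_lt]
  refine ⟨c₁ * ((2 : ℝ) ^ (2 * s))⁻¹, by positivity, fun η => le_trans ?_ (hb _).1⟩
  rw [mul_assoc]
  refine mul_le_mul_of_nonneg_left ?_ hc₁.le
  rw [inv_mul_le_iff₀ (by positivity), Real.norm_eq_abs]
  have h1 : |η| ≤ |-(2 * Real.pi * η)| := by
    rw [abs_neg, abs_mul]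
    refine le_mul_of_one_le_left (abs_nonneg _) ?_
    rw [abs_of_pos (by positivity)]
    linarith [Real.pi_gt_three]
  have h2 : 1 + |η| ≤ 2 * max 1 |η| := by
    linarith [le_max_left 1 |η|, le_max_right 1 |η|]
  calc (1 + |η|) ^ (2 * s) ≤ (2 * max 1 |η|) ^ (2 * s) := by gcongr
    _ = 2 ^ (2 * s) * (max 1 |η|) ^ (2 * s) := Real.mul_rpow (by norm_num) (by positivity)
    _ ≤ 2 ^ (2 * s) * (1 + |η| ^ (2 * s)) := by
        gcongr
        rcases max_choice 1 |η| with h | h <;> rw [h]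
        · rw [Real.one_rpow]
          linarith [Real.rpow_nonneg (abs_nonneg η) (2 * s)]
        · linarith
    _ ≤ 2 ^ (2 * s) * (1 + |-(2 * Real.pi * η)| ^ (2 * s)) := by gcongr

/-- For `z` outside `[c, ∞)` the function `(α - z)⁻¹` is bounded and square-integrable. -/
theorem memLp_inv_sub (hα : SymbolAssumption α s) {c : ℝ} (hc : 0 < c)
    (hb : ∀ η, c * (1 + ‖η‖) ^ (2 * s) ≤ rescale α η) {z : ℂ} (hz : ∀ r : ℝ, c ≤ r → z ≠ r) :
    MemLp (fun η => ((rescale α η : ℂ) - z)⁻¹) ∞ volume ∧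
    MemLp (fun η => ((rescale α η : ℂ) - z)⁻¹) 2 volume ∧
    ∀ η, ((rescale α η : ℂ) - z) * ((rescale α η : ℂ) - z)⁻¹ = 1 := by
  have hs : 1 < 2 * s := by linarith [hα.half_lt]
  have hm : AEStronglyMeasurable (fun η => ((rescale α η : ℂ) - z)⁻¹) volume := by
    have : Measurable (rescale α) := hα.measurable.comp (by fun_prop)
    exact (by fun_prop : Measurable fun η => ((rescale α η : ℂ) - z)⁻¹).aestronglyMeasurable
  have h1 : ∀ η : ℝ, 1 ≤ (1 + ‖η‖) ^ (2 * s) := fun η =>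
    Real.one_le_rpow (by linarith [norm_nonneg η]) (by linarith)
  have hcα : ∀ η, c ≤ rescale α η := fun η =>
    (le_mul_of_one_le_right hc.le (h1 η)).trans (hb η)
  obtain ⟨ε, hε, hle⟩ := exists_mul_le_norm_sub hc hz
  have hbd : ∀ η, ‖((rescale α η : ℂ) - z)⁻¹‖ ≤ (ε * c)⁻¹ * (1 + ‖η‖) ^ (-(2 * s)) := fun η => by
    rw [norm_inv, Real.rpow_neg (by positivity), ← mul_inv]
    refine inv_anti₀ (by have := h1 η; positivity) ?_
    rw [mul_assoc]
    exact (mul_le_mul_of_nonneg_left (hb η) hε.le).trans (hle _ (hcα η))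
  have hbd' : ∀ η, ‖((rescale α η : ℂ) - z)⁻¹‖ ≤ (ε * c)⁻¹ := fun η => by
    refine (hbd η).trans (mul_le_of_le_one_right (by positivity) ?_)
    rw [Real.rpow_neg (by positivity)]
    exact inv_le_one_of_one_le₀ (h1 η)
  refine ⟨memLp_top_of_bound hm _ (Eventually.of_forall hbd'), ?_, fun η => ?_⟩
  · rw [memLp_two_iff_integrable_sq_norm hm]
    have hi : Integrable fun η : ℝ => (ε * c)⁻¹ * ((ε * c)⁻¹ * (1 + ‖η‖) ^ (-(2 * s))) :=
      ((integrable_one_add_norm (by simpa using hs)).const_mul _).const_mul _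
    refine hi.mono' (hm.norm.pow 2) (Eventually.of_forall fun η => ?_)
    rw [Real.norm_of_nonneg (by positivity), sq]
    exact mul_le_mul (hbd' η) (hbd η) (norm_nonneg _) (by positivity)
  · refine mul_inv_cancel₀ (norm_pos_iff.mp (lt_of_lt_of_le ?_ (hle _ (hcα η))))
    have := hcα η
    have : 0 < rescale α η := by linarith
    positivity

end Symbol

/-! ### The potential `f'(φ)` -/

/-- Sobolev embedding: a function in `H^s(ℝ)` with `s > 1/2` is essentially bounded. -/
theorem exists_ae_norm_le_of_memSobolev {s : ℝ} (hs : 1 / 2 < s) {u : L2}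
    (hu : TemperedDistribution.MemSobolev s 2 (u : 𝓢'(ℝ, ℂ))) :
    ∃ M : ℝ, ∀ᵐ x, ‖u x‖ ≤ M := by
  obtain ⟨v, hv⟩ := hu.fourier_memL1 (by simp; linarith)
  refine ⟨∫ ξ, ‖v ξ‖, ?_⟩
  filter_upwards [ae_eq_fourierInv_of_fourier_eq u v hv] with x hx
  rw [hx]
  exact VectorFourier.norm_fourierIntegral_le_integral_norm _ _ _ _ _

/-- The growth condition makes `f'(φ)` bounded and square-integrable for bounded `φ ∈ L²`, since
`|f'(r)| ≤ C_M |r|` for `|r| ≤ M`. -/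
theorem NonlinearityAssumption.memLp_deriv_comp {f : ℝ → ℝ} (hf : NonlinearityAssumption f)
    (φ : Lp ℝ 2 (volume : Measure ℝ)) {M : ℝ} (hM : ∀ᵐ x, |φ x| ≤ M) :
    MemLp (fun x => ((deriv f (φ x) : ℝ) : ℂ)) ∞ volume ∧
    MemLp (fun x => ((deriv f (φ x) : ℝ) : ℂ)) 2 volume := by
  obtain ⟨q₁, q₂, C, hq₁, hq, hC, hb⟩ := hf.growth
  have hm : AEStronglyMeasurable (fun x => ((deriv f (φ x) : ℝ) : ℂ)) volume :=
    Complex.continuous_ofReal.comp_aestronglyMeasurable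
      ((hf.contDiff.continuous_deriv (by norm_num)).comp_aestronglyMeasurable
        (Lp.aestronglyMeasurable φ))
  have hpow : ∀ q : ℝ, 2 ≤ q → ∀ r : ℝ, |r| ≤ M → |r| ^ (q - 1) ≤ M ^ (q - 2) * |r| := by
    intro q hq r hr
    rcases (abs_nonneg r).eq_or_lt with h | h
    · rw [← h, Real.zero_rpow (by linarith), mul_zero]
    · rw [show q - 1 = (q - 2) + 1 by ring, Real.rpow_add_one h.ne']
      gcongr
  have hle : ∀ᵐ x, ‖((deriv f (φ x) : ℝ) : ℂ)‖ ≤ C * (M ^ (q₁ - 2) + M ^ (q₂ - 2)) * ‖φ x‖ := by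
    filter_upwards [hM] with x hx
    rw [Complex.norm_real, Real.norm_eq_abs, Real.norm_eq_abs, mul_assoc, add_mul]
    refine (hb (φ x)).trans (mul_le_mul_of_nonneg_left ?_ hC.le)
    exact add_le_add (hpow _ hq₁ _ hx) (hpow _ (hq₁.trans hq) _ hx)
  refine ⟨memLp_top_of_bound hm (C * (M ^ (q₁ - 2) + M ^ (q₂ - 2)) * M) ?_,
    (Lp.memLp φ).of_le_mul hm hle⟩
  filter_upwards [hle, hM] with x h1 h2
  have hM0 : 0 ≤ M := (abs_nonneg _).trans h2
  refine h1.trans ?_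
  rw [Real.norm_eq_abs]
  gcongr

end SolitaryWave

theorem theoremT (α f : ℝ → ℝ) (s : ℝ)
    (hα : SolitaryWave.SymbolAssumption α s)
    (hf : SolitaryWave.NonlinearityAssumption f)
    (φ : Lp ℝ 2 (volume : Measure ℝ)) (hφ₀ : φ ≠ 0)
    (hφ : SolitaryWave.IsSolution α f s φ)
    (h1 : SolitaryWave.H1 (SolitaryWave.linearizedOp α f φ))
    (h2 : SolitaryWave.H2 (SolitaryWave.linearizedOp α f φ) φ) :
    SolitaryWave.H3 (SolitaryWave.linearizedOp α f φ) := by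
  open SolitaryWave in
  obtain ⟨M, hM⟩ := exists_ae_norm_le_of_memSobolev hα.half_lt hφ.memSobolev
  have hM' : ∀ᵐ x, |φ x| ≤ M := by
    filter_upwards [hM, Complex.ofRealCLM.coeFn_compLp φ] with x hx hx'
    rw [toComplex, hx'] at hx
    simpa using hx
  obtain ⟨hV, hV2⟩ := hf.memLp_deriv_comp φ hM'
  obtain ⟨c, hc, hb⟩ := hα.exists_le_rescale
  set B : L2 →L[ℂ] L2 := mulCLM _ hV with hB
  have hdom : (linearizedOp α f φ).domain = (multiplierOp α).domain :=
    inf_eq_left.mpr fun v _ => mem_mulOp_domain_of_memLp_top hV v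
  have hT : ∀ x (h : x ∈ (linearizedOp α f φ).domain) (h' : x ∈ (multiplierOp α).domain),
      linearizedOp α f φ ⟨x, h⟩ = multiplierOp α ⟨x, h'⟩ - B x := fun x h h' => by
    rw [hB, ← mulOp_eq_mulCLM hV ⟨x, mem_mulOp_domain_of_memLp_top hV x⟩]
    exact LinearPMap.sub_apply _ _ _
  have hsymm : ∀ x y : (linearizedOp α f φ).domain,
      inner ℂ (linearizedOp α f φ x) (y : L2) = inner ℂ (x : L2) (linearizedOp α f φ y) := by
    rintro ⟨x, hx⟩ ⟨y, hy⟩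
    have h := mulOp_symmetric _ ⟨x, mem_mulOp_domain_of_memLp_top hV x⟩
      ⟨y, mem_mulOp_domain_of_memLp_top hV y⟩
    rw [mulOp_eq_mulCLM hV, mulOp_eq_mulCLM hV] at h
    rw [hT x hx (hdom ▸ hx), hT y hy (hdom ▸ hy), inner_sub_left, inner_sub_right]
    exact congrArg₂ (· - ·) (multiplierOp_symmetric α ⟨x, hdom ▸ hx⟩ ⟨y, hdom ▸ hy⟩) h
  have hres : ∀ z : ℂ, (∀ r : ℝ, c ≤ r → z ≠ r) → ∃ R : L2 →L[ℂ] L2,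
      (∀ y, ∃ h : R y ∈ (multiplierOp α).domain, multiplierOp α ⟨R y, h⟩ - z • R y = y) ∧
      (∀ x : (multiplierOp α).domain, R (multiplierOp α x - z • (x : L2)) = x) ∧
      IsCompactOperator (B ∘L R) := fun z hz => by
    obtain ⟨hg, hg2, hgα⟩ := memLp_inv_sub hα hc hb hz
    refine ⟨multiplierCLM _ hg, multiplierOp_multiplierCLM hg hgα,
      multiplierCLM_multiplierOp hg hgα, ?_⟩
    exact (isCompactOperator_mul_fourierInv_mul hV2 hV hg2 hg).comp_clm
      (Lp.fourierTransformₗᵢ ℝ ℂ).toContinuousLinearEquiv.toContinuousLinearMap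
  obtain ⟨R, hR, hR', hK⟩ := hres 0 fun r hr => by
    have : (0 : ℝ) ≠ r := (hc.trans_le hr).ne
    exact_mod_cast this
  obtain ⟨δ, hδ, hgap⟩ := exists_forall_lt_not_isEigenvalue hdom hT hsymm (R := R)
    (fun y => by simpa using hR y) (fun x => by simpa using hR' x) hK
  refine ⟨min δ c, lt_min hδ hc, fun z hz hz0 hneg => ?_⟩
  by_cases hzc : ∃ r : ℝ, c ≤ r ∧ z = r
  · obtain ⟨r, hr, rfl⟩ := hzc
    exact ⟨r, min_le_of_right_le hr, rfl⟩
  · push Not at hzc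
    obtain ⟨R, hR, hR', hK⟩ := hres z hzc
    have hev := isEigenvalue_of_mem_spectrum hdom hT hR hR' hK hz
    have hre := hev.eq_re hsymm
    refine ⟨z.re, min_le_of_left_le (not_lt.mp fun hlt => ?_), hre⟩
    rw [hre] at hev
    rcases lt_trichotomy z.re 0 with h | h | h
    · exact hneg ⟨z.re, h, hev, hre⟩
    · exact hz0 (by rw [hre, h, Complex.ofReal_zero])
    · exact hgap _ h hlt hev
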